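/- Let $d\in\{2,3\}$ and let $\Omega\subset\mathbb R^d$ be a bounded domain (open, connected, nonempty). Fix a reference finite element: a compact cell $\hat K\subset\mathbb R^d$ with nonempty interior and Lebesgue-null boundary, and a finite-dimensional space of shape functions $\hat P\subset H^1(\hat K)$ (Sobolev spaces of the cell are understood on its interior). An affine mesh $\mathcal T_h$ of $\Omega$ is a finite collection of cells $K=F_K(\hat K)$, with affine bijections $F_K:\mathbb R^d\to\mathbb R^d$, whose interiors are pairwise disjoint and contained in $\Omega$ and whose union is $\overline\Omega$; its mesh diameter is $h=\max_K\operatorname{diam}K$. For $\rho>0$, the mesh is called $\rho$-quasi-uniform if every cell contains a closed ball of diameter $\rho h$. A conforming finite element space on $\mathcal T_h$ is a linear subspace $\mathcal V_h\subseteq H^1(\Omega)$ such that $v_h\circ F_K|_{\hat K}\in\hat P$ (up to null sets) for all $v_h\in\mathcal V_h$ and all cells $K$. For a constant parameter $y>0$ let $$\mathcal V_{h,0}=\Big\{\phi_h\in\mathcal V_h:\int_\Omega\phi_h\,dx=0\Big\},\qquad \|\phi_h\|_{h,y}=\|y^{1/2}\nabla\phi_h\|_{L^2(\Omega)},$$ and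 let $\mathcal V_{h,y}'$ be the dual space of $(\mathcal V_{h,0},\|\cdot\|_{h,y})$, with dual norm $$\|s_h\|_{\mathcal V_{h,y}'}=\sup_{\substack{l_h\in\mathcal V_{h,0}\\ \|l_h\|_{h,y}\ne0}}\frac{\langle s_h,l_h\rangle}{\|l_h\|_{h,y}}$$ (taken to be $0$ if $\mathcal V_{h,0}=\{0\}$), where $q_h\in\mathcal V_{h,0}$ is identified with the functional $l_h\mapsto(q_h,l_h)_{L^2(\Omega)}$. **Lemma (inverse inequality in the dual norm).** For all $\rho>0$ and $y>0$ there is a constant $C_{\mathrm{inv}}>0$, depending only on $d$, $\Omega$, $(\hat K,\hat P)$, $\rho$ and $y$ (in particular not on $h$, the mesh, $\mathcal V_h$ or $q_h$), such that for every $\rho$-quasi-uniform affine mesh $\mathcal T_h$ of $\Omega$ generated by $(\hat K,\hat P)$, every conforming finite element space $\mathcal V_h$ on $\mathcal T_h$, and every $q_h\in\mathcal V_{h,0}$, $$\|q_h\|_{L^2(\Omega)}\le\frac{C_{\mathrm{inv}}}{h}\,\|q_h\|_{\mathcal V_{h,y}'}.$$ -/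

import Mathlib

open MeasureTheory
open scoped ContDiff

noncomputable section

namespace FEInverse

/-- Euclidean space `ℝᵈ`. -/
abbrev Space (d : ℕ) : Type := EuclideanSpace ℝ (Fin d)

/-- The Hilbert space `L²(Ω)` of real-valued functions. -/
abbrev L2 {d : ℕ} (Ω : Set (Space d)) : Type := Lp ℝ 2 (volume.restrict Ω)

/-- The Hilbert space `L²(Ω)ᵈ` of vector fields. -/
abbrev L2Vec {d : ℕ} (Ω : Set (Space d)) : Type := Lp (Space d) 2 (volume.restrict Ω)

/-- `G ∈ L²(Ω)ᵈ` is a weak gradient of `u ∈ L²(Ω)`: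
`∫_Ω u ∂ₑφ = - ∫_Ω (G · e) φ` for all test functions `φ ∈ C_c^∞(Ω)` and all directions `e`. -/
def IsWeakGradient {d : ℕ} (Ω : Set (Space d)) (u : L2 Ω) (G : L2Vec Ω) : Prop :=
  ∀ φ : Space d → ℝ, ContDiff ℝ ∞ φ → HasCompactSupport φ → tsupport φ ⊆ Ω →
    ∀ e : Space d,
      ∫ x in Ω, u x * fderiv ℝ φ x e = - ∫ x in Ω, inner ℝ (G x) e * φ x

/-- `u ∈ H¹(Ω)`: the function `u ∈ L²(Ω)` has a weak gradient in `L²(Ω)ᵈ`. -/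
def MemH1 {d : ℕ} (Ω : Set (Space d)) (u : L2 Ω) : Prop :=
  ∃ G : L2Vec Ω, IsWeakGradient Ω u G

/-- On an open set the weak gradient is unique. -/
theorem IsWeakGradient.unique {d : ℕ} {Ω : Set (Space d)} (hΩ : IsOpen Ω) {u : L2 Ω}
    {G G' : L2Vec Ω} (h : IsWeakGradient Ω u G) (h' : IsWeakGradient Ω u G') : G = G' := by
  have loc : ∀ H : L2Vec Ω, LocallyIntegrableOn H Ω := fun H => by
    have h1 : LocallyIntegrable H (volume.restrict Ω) :=
      (Lp.memLp H).locallyIntegrable (by norm_num)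
    intro x hx
    obtain ⟨U, hU, hi⟩ := h1 x
    refine ⟨U ∩ Ω, Filter.inter_mem (mem_nhdsWithin_of_mem_nhds hU) self_mem_nhdsWithin, ?_⟩
    rw [IntegrableOn, ← Measure.restrict_restrict_of_subset Set.inter_subset_right]
    exact hi.mono_set Set.inter_subset_left
  have key : ∀ᵐ x, x ∈ Ω → (G x - G' x) = 0 := by
    refine hΩ.ae_eq_zero_of_integral_contDiff_smul_eq_zero ((loc G).sub (loc G')) ?_
    intro φ hφ hc hs
    have int : ∀ H : L2Vec Ω, Integrable (fun x => φ x • H x) (volume.restrict Ω) := fun H => by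
      have hm : MemLp φ 2 (volume.restrict Ω) :=
        (hφ.continuous.memLp_of_hasCompactSupport hc).restrict Ω
      exact memLp_one_iff_integrable.1 ((Lp.memLp H).smul hm)
    have red : ∀ x, x ∉ Ω → φ x • (G x - G' x) = 0 := fun x hx => by
      rw [image_eq_zero_of_notMem_tsupport (fun hx' => hx (hs hx')), zero_smul]
    rw [← setIntegral_eq_integral_of_forall_compl_eq_zero red]
    simp only [smul_sub]
    rw [integral_sub (int G) (int G'), sub_eq_zero]
    have e1 : ∀ (H : L2Vec Ω) (e : Space d), IsWeakGradient Ω u H →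
        inner ℝ e (∫ x in Ω, φ x • H x) = - ∫ x in Ω, u x * fderiv ℝ φ x e := fun H e hH => by
      rw [hH φ hφ hc hs e, neg_neg, ← integral_inner (int H) e]
      refine integral_congr_ae (Filter.Eventually.of_forall fun x => ?_)
      simp only [inner_smul_right, real_inner_comm, mul_comm]
    exact ext_inner_left ℝ fun e => by rw [e1 G e h, e1 G' e h']
  refine Lp.ext ((ae_restrict_iff' hΩ.measurableSet).2 ?_)
  filter_upwards [key] with x hx hxΩ using sub_eq_zero.1 (hx hxΩ)

open Classical in
/-- The weak gradient `∇u ∈ L²(Ω)ᵈ` of `u ∈ H¹(Ω)` (and `0` if `u ∉ H¹(Ω)`). -/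
def weakGradient {d : ℕ} (Ω : Set (Space d)) (u : L2 Ω) : L2Vec Ω :=
  if h : MemH1 Ω u then h.choose else 0

/-- A reference finite element: a compact cell `K̂` with nonempty interior and Lebesgue-null
boundary, and a finite-dimensional space `P̂ ⊆ H¹(K̂)` of shape functions.  The degrees of
freedom play no role here: they are only used to single out a subspace of the
piecewise-`P̂` functions, and all conforming subspaces are admitted below. -/
structure ReferenceElement (d : ℕ) where
  cell : Set (Space d)
  isCompact_cell : IsCompact cell
  nonempty_interior : (interior cell).Nonempty
  frontier_null : volume (frontier cell) = 0
  shape : Submodule ℝ (L2 (interior cell))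
  finiteDimensional_shape : FiniteDimensional ℝ shape
  shape_subset_H1 : ∀ p ∈ shape, MemH1 (interior cell) p

/-- An affine mesh of `Ω` generated by the reference element `R`.  It is given by the finite set
of the affine bijections `F`, with mesh cells `K = F(K̂)`; the cells have pairwise disjoint
interiors contained in `Ω`, and they cover the closure of `Ω`. -/
structure AffineMesh {d : ℕ} (R : ReferenceElement d) (Ω : Set (Space d)) where
  maps : Finset (Space d ≃ᵃ[ℝ] Space d)
  cover : ⋃ F ∈ maps, F '' R.cell = closure Ω
  interior_subset : ∀ F ∈ maps, interior (F '' R.cell) ⊆ Ω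
  disjoint_interior : ∀ F ∈ maps, ∀ F' ∈ maps, F ≠ F' →
    Disjoint (interior (F '' R.cell)) (interior (F' '' R.cell))

/-- The mesh diameter `h`, the maximum of the diameters of the cells. -/
def AffineMesh.meshDiam {d : ℕ} {R : ReferenceElement d} {Ω : Set (Space d)}
    (T : AffineMesh R Ω) : ℝ :=
  ⨆ F : T.maps, Metric.diam (F.1 '' R.cell)

/-- Quasi-uniformity with constant `ρ`: each cell contains a ball of diameter `ρ h`. -/
def AffineMesh.QuasiUniform {d : ℕ} {R : ReferenceElement d} {Ω : Set (Space d)}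
    (T : AffineMesh R Ω) (ρ : ℝ) : Prop :=
  ∀ F ∈ T.maps, ∃ x : Space d, Metric.closedBall x (ρ * T.meshDiam / 2) ⊆ F '' R.cell

/-- `V` is an `H¹(Ω)`-conforming finite element space on the mesh: `V ⊆ H¹(Ω)`, and on each cell
`K = F(K̂)` each `v ∈ V` is, up to null sets, of the form `p ∘ F⁻¹` with `p ∈ P̂`. -/
def AffineMesh.IsConformingSpace {d : ℕ} {R : ReferenceElement d} {Ω : Set (Space d)}
    (T : AffineMesh R Ω) (V : Submodule ℝ (L2 Ω)) : Prop :=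
  ∀ v ∈ V, MemH1 Ω v ∧
    ∀ F ∈ T.maps, ∃ p ∈ R.shape,
      (fun x => v (F x)) =ᵐ[volume.restrict (interior R.cell)] p

/-- The subspace `V₀` of the mean-zero functions in `V`.  (Integrability is automatic on bounded
domains.) -/
def meanZero {d : ℕ} {Ω : Set (Space d)} (V : Submodule ℝ (L2 Ω)) : Submodule ℝ (L2 Ω) where
  carrier := {v | v ∈ V ∧ Integrable v (volume.restrict Ω) ∧ ∫ x in Ω, v x = 0}
  zero_mem' := by
    have h0 : ((0 : L2 Ω) : Space d → ℝ) =ᵐ[volume.restrict Ω] 0 := Lp.coeFn_zero _ _ _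
    refine ⟨V.zero_mem, (integrable_congr h0).2 (integrable_zero _ _ _), ?_⟩
    rw [integral_congr_ae h0]
    simp
  add_mem' := by
    rintro a b ⟨ha, hai, ha0⟩ ⟨hb, hbi, hb0⟩
    have h := Lp.coeFn_add a b
    refine ⟨V.add_mem ha hb, (integrable_congr h).2 (hai.add hbi), ?_⟩
    rw [integral_congr_ae h]
    simp only [Pi.add_apply]
    rw [integral_add hai hbi, ha0, hb0, add_zero]
  smul_mem' := by
    rintro c a ⟨ha, hai, ha0⟩
    have h := Lp.coeFn_smul c a
    refine ⟨V.smul_mem c ha, (integrable_congr h).2 (hai.smul c), ?_⟩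
    rw [integral_congr_ae h]
    simp only [Pi.smul_apply]
    rw [integral_smul, ha0, smul_zero]

/-- The parameter-dependent norm `‖v‖_{h,y} = ‖y^{1/2} ∇v‖_{L²(Ω)}`. -/
def energyNorm {d : ℕ} {Ω : Set (Space d)} (y : ℝ) (v : L2 Ω) : ℝ :=
  ‖Real.sqrt y • weakGradient Ω v‖

/-- The dual norm of a functional `s` on `(V₀, ‖·‖_{h,y})`:
the supremum of `⟨s, l⟩ / ‖l‖_{h,y}` over `l ∈ V₀` with `‖l‖_{h,y} ≠ 0`. -/
def dualNorm {d : ℕ} {Ω : Set (Space d)} (y : ℝ) (V₀ : Submodule ℝ (L2 Ω))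
    (s : Module.Dual ℝ V₀) : ℝ :=
  sSup {r : ℝ | ∃ l : V₀, energyNorm y (l : L2 Ω) ≠ 0 ∧ r = s l / energyNorm y (l : L2 Ω)}

/-- The functional `l ↦ (q, l)_{L²(Ω)}` on `V₀` with which `q ∈ V₀` is identified. -/
def toDual {d : ℕ} {Ω : Set (Space d)} (V₀ : Submodule ℝ (L2 Ω)) (q : V₀) :
    Module.Dual ℝ V₀ :=
  (innerSL ℝ (q : L2 Ω)).toLinearMap.domRestrict V₀

end FEInverse

end

/-! Testing the dual norm with `l = q` gives ‖q‖² ≤ ‖q‖_* ‖q‖_{h,y}, so the claim reduces to the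
classical inverse inequality ‖∇v‖ ≤ (c/h)‖v‖ (`AffineMesh.norm_weakGradient_le`). That one follows
by scaling. On the reference cell the gradient is a linear map on a finite-dimensional space, hence
bounded in L². With A the linear part of F, a gradient G pulls back to Aᵀ(G ∘ F), and a ball of
diameter ρh inside F(K̂) forces ‖A⁻¹‖ ≤ diam K̂ / (ρh). The Jacobian cancels, and the squared cell
estimates add up.

Two points make the test legitimate. First, ‖q‖_{h,y} ≠ 0 for q ≠ 0: on a connected open set a zero
weak gradient forces a constant, and zero mean makes it vanish. Second, a real `sSup` dominates its
members only if the set is bounded above; this holds since the gradient is injective on the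
finite-dimensional V₀. The resulting Poincaré constant may depend on the mesh, as it does not enter
`Cinv`. -/

noncomputable section

namespace FEInverse

/-! ### Affine changes of variables -/

/-- The linear part of an affine bijection of `ℝᵈ`, as a continuous linear equivalence. -/
def linearPart {d : ℕ} (F : Space d ≃ᵃ[ℝ] Space d) : Space d ≃L[ℝ] Space d :=
  F.linear.toContinuousLinearEquiv

theorem affineEquiv_apply {d : ℕ} (F : Space d ≃ᵃ[ℝ] Space d) (x : Space d) :
    F x = linearPart F x + F 0 := by
  have := F.map_vadd 0 x
  simpa [linearPart] using this

theorem continuous_affineEquiv {d : ℕ} (F : Space d ≃ᵃ[ℝ] Space d) : Continuous F := by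
  rw [show (F : Space d → Space d) = fun x => linearPart F x + F 0 from
    funext (affineEquiv_apply F)]
  fun_prop

/-- An affine bijection of `ℝᵈ` as a homeomorphism. -/
def affineHomeomorph {d : ℕ} (F : Space d ≃ᵃ[ℝ] Space d) : Space d ≃ₜ Space d where
  toEquiv := F.toEquiv
  continuous_toFun := continuous_affineEquiv F
  continuous_invFun := continuous_affineEquiv F.symm

theorem contDiff_affineEquiv {d : ℕ} (F : Space d ≃ᵃ[ℝ] Space d) : ContDiff ℝ ∞ F := by
  rw [show (F : Space d → Space d) = fun x => linearPart F x + F 0 from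
    funext (affineEquiv_apply F)]
  fun_prop

theorem measurableEmbedding_affineEquiv {d : ℕ} (F : Space d ≃ᵃ[ℝ] Space d) :
    MeasurableEmbedding F :=
  (affineHomeomorph F).measurableEmbedding

/-- Change of variables: `F` maps the volume on `S` to a multiple of the volume on `F '' S`. -/
theorem exists_map_restrict_eq {d : ℕ} (F : Space d ≃ᵃ[ℝ] Space d) :
    ∃ c : ℝ, 0 < c ∧ ∀ S : Set (Space d),
      Measure.map F (volume.restrict S) = ENNReal.ofReal c • volume.restrict (F '' S) := by
  have hdet : LinearMap.det (F.linear : Space d →ₗ[ℝ] Space d) ≠ 0 :=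
    (LinearEquiv.isUnit_det' F.linear).ne_zero
  refine ⟨|(LinearMap.det (F.linear : Space d →ₗ[ℝ] Space d))⁻¹|,
    abs_pos.2 (inv_ne_zero hdet), fun S => ?_⟩
  have h1 : Measure.map F (volume : Measure (Space d)) =
      ENNReal.ofReal |(LinearMap.det (F.linear : Space d →ₗ[ℝ] Space d))⁻¹| • volume := by
    have hF : (F : Space d → Space d) = (fun x => x + F 0) ∘ F.linear :=
      funext fun x => affineEquiv_apply F x
    have hm : Measurable F.linear := (linearPart F).continuous.measurable
    rw [hF, ← Measure.map_map (measurable_add_const _) hm]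
    have := Measure.map_linearMap_addHaar_eq_smul_addHaar (volume : Measure (Space d)) hdet
    rw [LinearEquiv.coe_coe] at this
    rw [this, Measure.map_smul, map_add_right_eq_self]
  have h2 := (measurableEmbedding_affineEquiv F).restrict_map volume (F '' S)
  rw [Set.preimage_image_eq _ F.injective] at h2
  rw [← h2, h1, Measure.restrict_smul]

/-- Change of variables for set integrals. -/
theorem exists_setIntegral_comp_eq {d : ℕ} (F : Space d ≃ᵃ[ℝ] Space d) :
    ∃ c : ℝ, 0 < c ∧ ∀ (S : Set (Space d)) (f : Space d → ℝ),
      ∫ x in S, f (F x) = c * ∫ x in F '' S, f x := by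
  obtain ⟨c, hc, h⟩ := exists_map_restrict_eq F
  refine ⟨c, hc, fun S f => ?_⟩
  rw [← (measurableEmbedding_affineEquiv F).integral_map, h, integral_smul_measure,
    ENNReal.toReal_ofReal hc.le, smul_eq_mul]

theorem memLp_comp_affineEquiv {d : ℕ} {E : Type*} [NormedAddCommGroup E]
    (F : Space d ≃ᵃ[ℝ] Space d) {S Ω : Set (Space d)} (h : F '' S ⊆ Ω)
    {f : Space d → E} {p : ENNReal} (hf : MemLp f p (volume.restrict Ω)) :
    MemLp (fun x => f (F x)) p (volume.restrict S) := by
  obtain ⟨c, _, hm⟩ := exists_map_restrict_eq F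
  refine (measurableEmbedding_affineEquiv F).memLp_map_measure_iff.1 ?_
  rw [hm]
  exact (hf.mono_measure (Measure.restrict_mono h le_rfl)).smul_measure ENNReal.ofReal_ne_top

theorem ae_comp_affineEquiv {d : ℕ} (F : Space d ≃ᵃ[ℝ] Space d) {S Ω : Set (Space d)}
    (h : F '' S ⊆ Ω) {p : Space d → Prop} (hp : ∀ᵐ x ∂volume.restrict Ω, p x) :
    ∀ᵐ x ∂volume.restrict S, p (F x) := by
  obtain ⟨c, _, hm⟩ := exists_map_restrict_eq F
  rw [← (measurableEmbedding_affineEquiv F).ae_map_iff, hm]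
  exact Measure.ae_smul_measure (ae_restrict_of_ae_restrict_of_subset h hp) _

theorem ae_of_ae_comp_affineEquiv {d : ℕ} (F : Space d ≃ᵃ[ℝ] Space d) {S : Set (Space d)}
    {p : Space d → Prop} (hp : ∀ᵐ x ∂volume.restrict S, p (F x)) :
    ∀ᵐ x ∂volume.restrict (F '' S), p x := by
  obtain ⟨c, hc, hm⟩ := exists_map_restrict_eq F
  rw [← (measurableEmbedding_affineEquiv F).ae_map_iff, hm] at hp
  exact (Measure.ae_ennreal_smul_measure_iff (ENNReal.ofReal_pos.2 hc).ne').1 hp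

/-! ### Pullback of functions and weak gradients -/

/-- The pullback `v ↦ v ∘ F` of square-integrable functions. -/
def pullback {d : ℕ} (F : Space d ≃ᵃ[ℝ] Space d) {S Ω : Set (Space d)} (h : F '' S ⊆ Ω) :
    L2 Ω →ₗ[ℝ] L2 S where
  toFun v := (memLp_comp_affineEquiv F h (Lp.memLp v)).toLp _
  map_add' u v := by
    rw [← MemLp.toLp_add]
    exact MemLp.toLp_congr _ _ (ae_comp_affineEquiv F h (Lp.coeFn_add u v))
  map_smul' a v := by
    rw [RingHom.id_apply, ← MemLp.toLp_const_smul]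
    exact MemLp.toLp_congr _ _ (ae_comp_affineEquiv F h (Lp.coeFn_smul a v))

theorem coeFn_pullback {d : ℕ} (F : Space d ≃ᵃ[ℝ] Space d) {S Ω : Set (Space d)}
    (h : F '' S ⊆ Ω) (v : L2 Ω) :
    pullback F h v =ᵐ[volume.restrict S] fun x => v (F x) :=
  MemLp.coeFn_toLp (memLp_comp_affineEquiv F h (Lp.memLp v))

/-- The pullback `Aᵀ (G ∘ F)` of a vector field, where `A` is the linear part of `F`. -/
def pullbackField {d : ℕ} (F : Space d ≃ᵃ[ℝ] Space d) {S Ω : Set (Space d)} (h : F '' S ⊆ Ω)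
    (G : L2Vec Ω) : L2Vec S :=
  (ContinuousLinearMap.adjoint (linearPart F : Space d →L[ℝ] Space d)).compLp
    ((memLp_comp_affineEquiv F h (Lp.memLp G)).toLp _)

theorem coeFn_pullbackField {d : ℕ} (F : Space d ≃ᵃ[ℝ] Space d) {S Ω : Set (Space d)}
    (h : F '' S ⊆ Ω) (G : L2Vec Ω) :
    pullbackField F h G =ᵐ[volume.restrict S] fun x =>
      ContinuousLinearMap.adjoint (linearPart F : Space d →L[ℝ] Space d) (G (F x)) := by
  filter_upwards [ContinuousLinearMap.coeFn_compLp
    (ContinuousLinearMap.adjoint (linearPart F : Space d →L[ℝ] Space d))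
    ((memLp_comp_affineEquiv F h (Lp.memLp G)).toLp _),
    MemLp.coeFn_toLp (memLp_comp_affineEquiv F h (Lp.memLp G))] with x h1 h2
  rw [pullbackField, h1, h2]

/-- Chain rule for weak gradients under affine bijections. -/
theorem IsWeakGradient.pullback {d : ℕ} (F : Space d ≃ᵃ[ℝ] Space d) {S Ω : Set (Space d)}
    (h : F '' S ⊆ Ω) {v : L2 Ω} {G : L2Vec Ω} (hG : IsWeakGradient Ω v G) :
    IsWeakGradient S (FEInverse.pullback F h v) (pullbackField F h G) := by
  intro φ hφ hc hs e
  -- The weak gradient on Ω is tested with φ ∘ F⁻¹ in the direction A e, because the derivative of ψ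
  -- at F x along A e is that of φ at x along e.
  set ψ : Space d → ℝ := fun x => φ (F.symm x) with hψ
  have hψF : ∀ x, ψ (F x) = φ x := fun x => by simp [hψ]
  have hψs : ContDiff ℝ ∞ ψ := hφ.comp (contDiff_affineEquiv F.symm)
  have hψc : HasCompactSupport ψ := hc.comp_homeomorph (affineHomeomorph F.symm)
  have hsub : tsupport ψ ⊆ F '' S := by
    have h1 : tsupport ψ = (affineHomeomorph F.symm) ⁻¹' tsupport φ :=
      tsupport_comp_eq_preimage φ (affineHomeomorph F.symm)
    rw [h1]
    intro x hx
    exact ⟨F.symm x, hs hx, by simp⟩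
  have hder : ∀ x, fderiv ℝ ψ (F x) (linearPart F e) = fderiv ℝ φ x e := fun x => by
    have hF : HasFDerivAt F (linearPart F : Space d →L[ℝ] Space d) x := by
      rw [show (F : Space d → Space d) = fun x => linearPart F x + F 0 from
        funext (affineEquiv_apply F)]
      exact (linearPart F).hasFDerivAt.add_const _
    have h1 : HasFDerivAt (fun x => ψ (F x))
        ((fderiv ℝ ψ (F x)).comp (linearPart F : Space d →L[ℝ] Space d)) x :=
      HasFDerivAt.comp (g := ψ) x ((hψs.differentiable (by norm_num)) (F x)).hasFDerivAt hF
    rw [funext hψF] at h1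
    rw [h1.fderiv]
    rfl
  obtain ⟨c, hc0, hcv⟩ := exists_setIntegral_comp_eq F
  have key := hG ψ hψs hψc (hsub.trans h) (linearPart F e)
  -- The integrands vanish off the support of ψ, which lies in F(S) ⊆ Ω, so the integrals over F(S)
  -- and over Ω both equal the one over the whole space.
  have hint : ∀ f : Space d → ℝ, (∀ x, x ∉ tsupport ψ → f x = 0) →
      ∫ x in S, f (F x) = c * ∫ x in Ω, f x := fun f hf => by
    rw [hcv, setIntegral_eq_integral_of_forall_compl_eq_zero fun x hx => hf x fun h' =>
        hx (hsub h'), setIntegral_eq_integral_of_forall_compl_eq_zero fun x hx => hf x fun h' =>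
        hx (h (hsub h'))]
  have hL : ∫ x in S, FEInverse.pullback F h v x * fderiv ℝ φ x e =
      c * ∫ x in Ω, v x * fderiv ℝ ψ x (linearPart F e) := by
    rw [← hint (fun x => v x * fderiv ℝ ψ x (linearPart F e)) fun x hx => by
      rw [image_eq_zero_of_notMem_tsupport fun h' => hx (tsupport_fderiv_subset ℝ h')]; simp]
    refine integral_congr_ae ?_
    filter_upwards [coeFn_pullback F h v] with x hx
    rw [hx, hder]
  have hR : ∫ x in S, inner ℝ (pullbackField F h G x) e * φ x =
      c * ∫ x in Ω, inner ℝ (G x) (linearPart F e) * ψ x := by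
    rw [← hint (fun x => inner ℝ (G x) (linearPart F e) * ψ x) fun x hx => by
      rw [image_eq_zero_of_notMem_tsupport hx]; simp]
    refine integral_congr_ae ?_
    filter_upwards [coeFn_pullbackField F h G] with x hx
    rw [hx, hψF, ContinuousLinearMap.adjoint_inner_left]
    rfl
  rw [hL, hR, key, mul_neg]

/-! ### Functions with vanishing weak gradient -/

/-- A function with vanishing weak gradient is constant on balls well inside the domain. -/
theorem IsWeakGradient.ae_eq_const_ball {d : ℕ} {Ω : Set (Space d)} (hΩ : IsOpen Ω) {u : L2 Ω}
    (hu : IsWeakGradient Ω u 0) {x : Space d} {r : ℝ} (hr : 0 < r)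
    (hx : Metric.ball x (2 * r) ⊆ Ω) :
    ∃ c : ℝ, ∀ᵐ z ∂volume, z ∈ Metric.ball x r → u z = c := by
  set g : Space d → ℝ := Ω.indicator u with hg_def
  have hg : LocallyIntegrable g volume :=
    ((memLp_indicator_iff_restrict hΩ.measurableSet).2 (Lp.memLp u)).locallyIntegrable
      (by norm_num)
  -- Mollifiers of radius at most r: centred in `ball x r`, their supports stay in `ball x (2 * r)`
  -- ⊆ Ω. The fixed ratio of the two radii gives a.e. convergence of the convolutions.
  let φ : ℕ → ContDiffBump (0 : Space d) := fun n =>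
    { rIn := r / 2 * (1 / ((n : ℝ) + 1))
      rOut := r * (1 / ((n : ℝ) + 1))
      rIn_pos := by positivity
      rIn_lt_rOut := by
        have : (0 : ℝ) < 1 / ((n : ℝ) + 1) := by positivity
        nlinarith }
  have hlim : Filter.Tendsto (fun n => (φ n).rOut) Filter.atTop (nhds 0) := by
    have := (tendsto_one_div_add_atTop_nhds_zero_nat (𝕜 := ℝ)).const_mul r
    rwa [mul_zero] at this
  have hK : ∀ᶠ n in Filter.atTop, (φ n).rOut ≤ 2 * (φ n).rIn :=
    Filter.Eventually.of_forall fun n => by simp only [φ]; linarith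
  have hconv := ContDiffBump.ae_convolution_tendsto_right_of_locallyIntegrable hlim hK hg
  have hout : ∀ n, (φ n).rOut ≤ r := fun n => by
    have : 1 / ((n : ℝ) + 1) ≤ 1 := by
      rw [div_le_one (by positivity)]; linarith [(Nat.cast_nonneg n : (0 : ℝ) ≤ n)]
    simp only [φ]; nlinarith
  have hconst : ∀ n, ∀ z ∈ Metric.ball x r, ∀ z' ∈ Metric.ball x r,
      convolution ((φ n).normed volume) g (ContinuousLinearMap.lsmul ℝ ℝ) volume z =
      convolution ((φ n).normed volume) g (ContinuousLinearMap.lsmul ℝ ℝ) volume z' := by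
    intro n z hz z' hz'
    set ψ := (φ n).normed (volume : Measure (Space d)) with hψ
    have hψc : HasCompactSupport ψ := (φ n).hasCompactSupport_normed
    have hψs : ContDiff ℝ ∞ ψ := (φ n).contDiff_normed
    have hψ1 : ContDiff ℝ 1 ψ := hψs.of_le (by norm_num)
    -- With the mollifier as the right factor, the derivative of the convolution falls on it.
    rw [← convolution_flip]
    have hd := fun p => hψc.hasFDerivAt_convolution_right (μ := volume)
      (ContinuousLinearMap.lsmul ℝ ℝ).flip hg hψ1 p
    refine Metric.isOpen_ball.is_const_of_fderiv_eq_zero (𝕜 := ℝ)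
      (convex_ball x r).isPreconnected (fun p _ => (hd p).differentiableAt.differentiableWithinAt)
      (fun p hp => ?_) hz hz'
    rw [(hd p).fderiv]
    ext e
    rw [convolution_precompR_apply _ hg (hψc.fderiv ℝ)
      (hψ1.continuous_fderiv one_ne_zero), convolution_def]
    simp only [ContinuousLinearMap.flip_apply, ContinuousLinearMap.lsmul_apply, smul_eq_mul,
      Pi.zero_apply, zero_apply]
    have hts : tsupport (fun t => ψ (p - t)) ⊆ Ω := by
      refine subset_trans (closure_minimal (t := Metric.closedBall p (φ n).rOut) (fun t ht => ?_)
        Metric.isClosed_closedBall) (subset_trans ?_ hx)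
      · have h1 : p - t ∈ Function.support ψ := ht
        rw [hψ, (φ n).support_normed_eq] at h1
        rw [Metric.mem_closedBall, dist_comm, dist_eq_norm]
        simpa using (mem_ball_zero_iff.1 h1).le
      · intro t ht
        rw [Metric.mem_closedBall] at ht
        rw [Metric.mem_ball] at hp ⊢
        linarith [dist_triangle t p x, hout n]
    have hcs : HasCompactSupport (fun t => ψ (p - t)) :=
      hψc.comp_homeomorph (Homeomorph.subLeft p)
    -- The derivative of the mollified function at p is, up to sign, the weak gradient identity for
    -- the test function t ↦ ψ(p - t), hence zero.
    have h := hu (fun t => ψ (p - t)) (hψs.comp (contDiff_const.sub contDiff_id)) hcs hts e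
    have h0 : ∫ t in Ω, inner ℝ ((0 : L2Vec Ω) t) e * ψ (p - t) = 0 := by
      rw [← integral_zero (Space d) ℝ (μ := volume.restrict Ω)]
      refine integral_congr_ae ?_
      filter_upwards [Lp.coeFn_zero (Space d) 2 (volume.restrict Ω)] with t ht
      rw [ht]; simp
    rw [h0, neg_zero] at h
    have hfd : ∀ t, fderiv ℝ (fun t => ψ (p - t)) t e = - fderiv ℝ ψ (p - t) e := fun t => by
      have h2 : HasFDerivAt (fun t => ψ (p - t))
          ((fderiv ℝ ψ (p - t)).comp (-ContinuousLinearMap.id ℝ (Space d))) t :=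
        HasFDerivAt.comp t ((hψ1.differentiable one_ne_zero) (p - t)).hasFDerivAt
          ((hasFDerivAt_id t).const_sub p)
      rw [h2.fderiv]; simp
    simp only [hfd, mul_neg, integral_neg, neg_eq_zero] at h
    rw [← h, ← integral_indicator hΩ.measurableSet]
    refine integral_congr_ae (Filter.Eventually.of_forall fun t => ?_)
    by_cases ht : t ∈ Ω <;> simp [hg_def, ht, mul_comm]
  -- One point of convergence in the ball fixes the constant. If there were none, the a.e. statement
  -- would hold vacuously on the ball.
  by_cases hne : ∃ z₀ ∈ Metric.ball x r, Filter.Tendsto (fun n => convolution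
      ((φ n).normed volume) g (ContinuousLinearMap.lsmul ℝ ℝ) volume z₀) Filter.atTop
      (nhds (g z₀))
  · obtain ⟨z₀, hz₀, hz₀l⟩ := hne
    refine ⟨g z₀, ?_⟩
    filter_upwards [hconv] with z hz hzB
    have hzΩ : z ∈ Ω := hx (Metric.ball_subset_ball (by linarith) hzB)
    have h1 : u z = g z := by simp [hg_def, hzΩ]
    rw [h1]
    refine tendsto_nhds_unique hz (hz₀l.congr fun n => hconst n _ hz₀ _ hzB)
  · refine ⟨0, ?_⟩
    filter_upwards [hconv] with z hz hzB
    exact absurd ⟨z, hzB, hz⟩ hne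

/-- On a domain, a function with vanishing weak gradient is constant. -/
theorem IsWeakGradient.ae_eq_const {d : ℕ} {Ω : Set (Space d)} (hΩ : IsOpen Ω)
    (hc : IsConnected Ω) {u : L2 Ω} (hu : IsWeakGradient Ω u 0) :
    ∃ c : ℝ, u =ᵐ[volume.restrict Ω] fun _ => c := by
  have hball : ∀ x ∈ Ω, ∃ r > 0, ∃ c : ℝ, Metric.ball x r ⊆ Ω ∧
      ∀ᵐ z ∂volume, z ∈ Metric.ball x r → u z = c := fun x hx => by
    obtain ⟨ε, hε, hb⟩ := Metric.isOpen_iff.1 hΩ x hx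
    obtain ⟨c, h⟩ := IsWeakGradient.ae_eq_const_ball hΩ hu (half_pos hε) (x := x)
      (by rwa [mul_div_cancel₀ _ two_ne_zero])
    exact ⟨ε / 2, half_pos hε, c, (Metric.ball_subset_ball (by linarith)).trans hb, h⟩
  let Q : Space d → ℝ → Prop := fun x c => ∃ r > 0, ∀ᵐ z ∂volume, z ∈ Metric.ball x r → u z = c
  have huniq : ∀ x c c', Q x c → Q x c' → c = c' := by
    rintro x c c' ⟨r, hr, h⟩ ⟨r', hr', h'⟩
    by_contra hcc
    have h0 : volume (Metric.ball x (min r r')) = 0 := by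
      refine measure_mono_null (fun z hz => ?_) (ae_iff.1 (h.and h'))
      intro hh
      exact hcc ((hh.1 (Metric.ball_subset_ball (min_le_left _ _) hz)).symm.trans
        (hh.2 (Metric.ball_subset_ball (min_le_right _ _) hz)))
    exact (Metric.measure_ball_pos volume x (lt_min hr hr')).ne' h0
  -- Having a common local constant is symmetric and transitive and holds between nearby points, so
  -- connectedness extends it to all pairs of points.
  have hpre : ∀ x ∈ Ω, ∀ x' ∈ Ω, ∃ c, Q x c ∧ Q x' c := fun _ ha _ hb => hc.isPreconnected.induction₂ (fun x x' => ∃ c, Q x c ∧ Q x' c)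
    (fun x hx => by
      obtain ⟨r, hr, c, _, h⟩ := hball x hx
      refine nhdsWithin_le_nhds (Filter.mem_of_superset (Metric.ball_mem_nhds x hr) fun z hz => ?_)
      refine ⟨c, ⟨r, hr, h⟩, r - dist z x, sub_pos.2 hz, ?_⟩
      filter_upwards [h] with t ht htz
      refine ht ?_
      rw [Metric.mem_ball] at htz ⊢
      linarith [dist_triangle t z x])
    (by
      rintro a b e _ _ _ ⟨c, h1, h2⟩ ⟨c', h3, h4⟩
      exact ⟨c, h1, huniq _ _ _ h2 h3 ▸ h4⟩)
    (by rintro a b _ _ ⟨c, h1, h2⟩; exact ⟨c, h2, h1⟩) ha hb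
  obtain ⟨x₀, hx₀⟩ := hc.nonempty
  obtain ⟨r₀, hr₀, c, _, h₀⟩ := hball x₀ hx₀
  refine ⟨c, (ae_restrict_iff' hΩ.measurableSet).2 ?_⟩
  refine measure_null_of_locally_null _ fun x hx => ?_
  have hxΩ : x ∈ Ω := by by_contra h; exact hx fun h' => absurd h' h
  obtain ⟨c', h1, r, hr, h2⟩ := hpre x₀ hx₀ x hxΩ
  rw [huniq x₀ c' c h1 ⟨r₀, hr₀, h₀⟩] at h2
  refine ⟨_, Filter.inter_mem (mem_nhdsWithin_of_mem_nhds (Metric.ball_mem_nhds x hr))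
    self_mem_nhdsWithin, measure_mono_null ?_ h2⟩
  rintro z ⟨hzB, hz⟩ hh
  exact hz fun _ => hh hzB

/-! ### Linearity of the weak gradient and its bound on shape functions -/

theorem MemH1.isWeakGradient {d : ℕ} {Ω : Set (Space d)} {u : L2 Ω} (hu : MemH1 Ω u) :
    IsWeakGradient Ω u (weakGradient Ω u) := by
  rw [weakGradient, dif_pos hu]
  exact hu.choose_spec

theorem integrable_mul_fderiv {d : ℕ} {Ω : Set (Space d)} (u : L2 Ω) {φ : Space d → ℝ}
    (hφ : ContDiff ℝ ∞ φ) (hc : HasCompactSupport φ) (e : Space d) :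
    Integrable (fun x => u x * fderiv ℝ φ x e) (volume.restrict Ω) := by
  have h : MemLp (fun x => fderiv ℝ φ x e) 2 (volume.restrict Ω) :=
    (((hφ.continuous_fderiv (by norm_num)).clm_apply continuous_const).memLp_of_hasCompactSupport
      (hc.fderiv_apply ℝ e)).restrict Ω
  exact (Lp.memLp u).integrable_mul h

theorem integrable_inner_mul {d : ℕ} {Ω : Set (Space d)} (G : L2Vec Ω) {φ : Space d → ℝ}
    (hφ : ContDiff ℝ ∞ φ) (hc : HasCompactSupport φ) (e : Space d) :
    Integrable (fun x => inner ℝ (G x) e * φ x) (volume.restrict Ω) := by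
  have h : MemLp φ 2 (volume.restrict Ω) :=
    (hφ.continuous.memLp_of_hasCompactSupport hc).restrict Ω
  exact ((Lp.memLp G).inner_const e).integrable_mul h

theorem IsWeakGradient.add {d : ℕ} {Ω : Set (Space d)} {u v : L2 Ω} {G H : L2Vec Ω}
    (hu : IsWeakGradient Ω u G) (hv : IsWeakGradient Ω v H) :
    IsWeakGradient Ω (u + v) (G + H) := by
  intro φ hφ hc hs e
  have h1 : ∫ x in Ω, (u + v : L2 Ω) x * fderiv ℝ φ x e =
      ∫ x in Ω, (u x * fderiv ℝ φ x e + v x * fderiv ℝ φ x e) := by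
    refine integral_congr_ae ?_
    filter_upwards [Lp.coeFn_add u v] with x hx
    rw [hx, Pi.add_apply, add_mul]
  have h2 : ∫ x in Ω, inner ℝ ((G + H : L2Vec Ω) x) e * φ x =
      ∫ x in Ω, (inner ℝ (G x) e * φ x + inner ℝ (H x) e * φ x) := by
    refine integral_congr_ae ?_
    filter_upwards [Lp.coeFn_add G H] with x hx
    rw [hx, Pi.add_apply, inner_add_left, add_mul]
  rw [h1, h2, integral_add (integrable_mul_fderiv u hφ hc e) (integrable_mul_fderiv v hφ hc e),
    integral_add (integrable_inner_mul G hφ hc e) (integrable_inner_mul H hφ hc e),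
    hu φ hφ hc hs e, hv φ hφ hc hs e, neg_add]

theorem IsWeakGradient.smul {d : ℕ} {Ω : Set (Space d)} (a : ℝ) {u : L2 Ω} {G : L2Vec Ω}
    (hu : IsWeakGradient Ω u G) : IsWeakGradient Ω (a • u) (a • G) := by
  intro φ hφ hc hs e
  have h1 : ∫ x in Ω, (a • u : L2 Ω) x * fderiv ℝ φ x e =
      ∫ x in Ω, a * (u x * fderiv ℝ φ x e) := by
    refine integral_congr_ae ?_
    filter_upwards [Lp.coeFn_smul a u] with x hx
    rw [hx, Pi.smul_apply, smul_eq_mul, mul_assoc]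
  have h2 : ∫ x in Ω, inner ℝ ((a • G : L2Vec Ω) x) e * φ x =
      ∫ x in Ω, a * (inner ℝ (G x) e * φ x) := by
    refine integral_congr_ae ?_
    filter_upwards [Lp.coeFn_smul a G] with x hx
    rw [hx, Pi.smul_apply, real_inner_smul_left, mul_assoc]
  rw [h1, h2, integral_const_mul, integral_const_mul, hu φ hφ hc hs e, mul_neg]

/-- The weak gradient as a linear map on a subspace of `H¹(Ω)`. -/
def gradientOn {d : ℕ} {Ω : Set (Space d)} (hΩ : IsOpen Ω) (V : Submodule ℝ (L2 Ω))
    (hV : ∀ v ∈ V, MemH1 Ω v) : V →ₗ[ℝ] L2Vec Ω where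
  toFun v := weakGradient Ω v
  map_add' u v := ((hV _ (u + v).2).isWeakGradient).unique hΩ
    ((hV _ u.2).isWeakGradient.add (hV _ v.2).isWeakGradient)
  map_smul' a v := ((hV _ (a • v).2).isWeakGradient).unique hΩ
    ((hV _ v.2).isWeakGradient.smul a)

/-- On the finite-dimensional space of shape functions, the gradient is bounded. -/
theorem ReferenceElement.exists_gradient_bound {d : ℕ} (R : ReferenceElement d) :
    ∃ C : ℝ, 0 ≤ C ∧ ∀ p ∈ R.shape, ∀ G : L2Vec (interior R.cell),
      IsWeakGradient (interior R.cell) p G → ‖G‖ ≤ C * ‖p‖ := by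
  have := R.finiteDimensional_shape
  let g := (gradientOn isOpen_interior R.shape R.shape_subset_H1).toContinuousLinearMap
  refine ⟨‖g‖, g.opNorm_nonneg, fun p hp G hG => ?_⟩
  rw [hG.unique isOpen_interior (R.shape_subset_H1 p hp).isWeakGradient]
  exact g.le_opNorm ⟨p, hp⟩

/-! ### Scaling on a single cell -/

theorem norm_sq_eq_integral {α E : Type*} [MeasurableSpace α] {μ : Measure α}
    [NormedAddCommGroup E] [InnerProductSpace ℝ E] (f : Lp E 2 μ) :
    ‖f‖ ^ 2 = ∫ x, ‖f x‖ ^ 2 ∂μ := by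
  rw [← real_inner_self_eq_norm_sq, L2.inner_def]
  simp only [real_inner_self_eq_norm_sq]

theorem integrable_norm_sq {α E : Type*} [MeasurableSpace α] {μ : Measure α}
    [NormedAddCommGroup E] (f : Lp E 2 μ) :
    Integrable (fun x => ‖f x‖ ^ 2) μ :=
  (Lp.memLp f).integrable_norm_pow two_ne_zero

/-- If the image of a bounded set under `F` contains a ball of radius `r`, then the inverse of
the linear part of `F` is bounded by the ratio of the diameters. -/
theorem norm_linearPart_symm_le {d : ℕ} (F : Space d ≃ᵃ[ℝ] Space d) {K : Set (Space d)}
    (hK : Bornology.IsBounded K) {x : Space d} {r : ℝ} (hr : 0 < r)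
    (hx : Metric.closedBall x r ⊆ F '' K) (w : Space d) :
    ‖(linearPart F).symm w‖ ≤ Metric.diam K / (2 * r) * ‖w‖ := by
  rcases eq_or_ne w 0 with rfl | hw
  · simp
  have hw' : 0 < ‖w‖ := norm_pos_iff.2 hw
  have hmem : ∀ s : ℝ, |s| = r → x + (s / ‖w‖) • w ∈ F '' K := fun s hs => hx <| by
    rw [Metric.mem_closedBall, dist_eq_norm, add_sub_cancel_left, norm_smul, norm_div, norm_norm,
      div_mul_cancel₀ _ hw'.ne', Real.norm_eq_abs, hs]
  obtain ⟨a, ha, hFa⟩ := hmem r (abs_of_pos hr)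
  obtain ⟨b, hb, hFb⟩ := hmem (-r) (by rw [abs_neg, abs_of_pos hr])
  -- The points x ± (r/‖w‖) w of the ball are 2r apart; their preimages a and b lie in K, so their
  -- distance is at most diam K.
  have hab : a - b = (2 * r / ‖w‖) • (linearPart F).symm w := by
    apply (linearPart F).injective
    rw [map_smul, ContinuousLinearEquiv.apply_symm_apply, map_sub]
    rw [affineEquiv_apply] at hFa hFb
    rw [eq_sub_of_add_eq hFa, eq_sub_of_add_eq hFb, sub_sub_sub_cancel_right,
      add_sub_add_left_eq_sub, ← sub_smul]
    congr 1
    ring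
  have h1 := Metric.dist_le_diam_of_mem hK ha hb
  rw [dist_eq_norm, hab, norm_smul, Real.norm_of_nonneg (by positivity)] at h1
  rw [div_mul_eq_mul_div, le_div_iff₀ (by positivity)]
  rw [div_mul_eq_mul_div, div_le_iff₀ hw'] at h1
  linarith

/-- Duality: ‖z‖² = ⟨z, A A⁻¹z⟩ = ⟨Aᵀz, A⁻¹z⟩, followed by Cauchy–Schwarz. This recovers G from its
pullback Aᵀ(G ∘ F). -/
theorem norm_le_mul_norm_adjoint {d : ℕ} (A : Space d ≃L[ℝ] Space d) {M : ℝ}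
    (hM : ∀ w, ‖A.symm w‖ ≤ M * ‖w‖) (z : Space d) :
    ‖z‖ ≤ M * ‖ContinuousLinearMap.adjoint (A : Space d →L[ℝ] Space d) z‖ := by
  rcases eq_or_ne z 0 with rfl | hz
  · simp
  have h1 : ‖z‖ * ‖z‖ ≤
      ‖ContinuousLinearMap.adjoint (A : Space d →L[ℝ] Space d) z‖ * (M * ‖z‖) := by
    rw [← real_inner_self_eq_norm_mul_norm]
    nth_rewrite 2 [← A.apply_symm_apply z]
    rw [← ContinuousLinearEquiv.coe_coe A, ← ContinuousLinearMap.adjoint_inner_left]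
    exact (real_inner_le_norm _ _).trans (mul_le_mul_of_nonneg_left (hM z) (norm_nonneg _))
  have hz' : 0 < ‖z‖ := norm_pos_iff.2 hz
  exact le_of_mul_le_mul_right (by linarith) hz'

/-- Scaling of a gradient bound from the reference cell to a mesh cell. -/
theorem setIntegral_norm_gradient_sq_le {d : ℕ} (F : Space d ≃ᵃ[ℝ] Space d)
    {S Ω : Set (Space d)} (h : F '' S ⊆ Ω) {v : L2 Ω} {G : L2Vec Ω} {M C : ℝ}
    (hM : ∀ w, ‖(linearPart F).symm w‖ ≤ M * ‖w‖)
    (hC : ‖pullbackField F h G‖ ≤ C * ‖pullback F h v‖) :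
    ∫ x in F '' S, ‖G x‖ ^ 2 ≤ (M * C) ^ 2 * ∫ x in F '' S, ‖v x‖ ^ 2 := by
  obtain ⟨c, hc, hcv⟩ := exists_setIntegral_comp_eq F
  have hv : ‖pullback F h v‖ ^ 2 = c * ∫ x in F '' S, ‖v x‖ ^ 2 := by
    rw [norm_sq_eq_integral, ← hcv]
    refine integral_congr_ae ?_
    filter_upwards [coeFn_pullback F h v] with x hx
    rw [hx]
  have hG : c * ∫ x in F '' S, ‖G x‖ ^ 2 ≤ M ^ 2 * ‖pullbackField F h G‖ ^ 2 := by
    rw [norm_sq_eq_integral, ← hcv, ← integral_const_mul]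
    refine integral_mono_ae
      ((memLp_comp_affineEquiv F h (Lp.memLp G)).integrable_norm_pow two_ne_zero)
      ((integrable_norm_sq _).const_mul _) ?_
    filter_upwards [coeFn_pullbackField F h G] with x hx
    rw [hx, ← mul_pow]
    exact pow_le_pow_left₀ (norm_nonneg _) (norm_le_mul_norm_adjoint _ hM _) 2
  have hC2 : ‖pullbackField F h G‖ ^ 2 ≤ C ^ 2 * ‖pullback F h v‖ ^ 2 := by
    rw [← mul_pow]
    exact pow_le_pow_left₀ (norm_nonneg _) hC 2
  -- The Jacobian factor c appears on both sides and cancels, so no bound on it is needed.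
  refine le_of_mul_le_mul_left ?_ hc
  calc c * ∫ x in F '' S, ‖G x‖ ^ 2 ≤ M ^ 2 * ‖pullbackField F h G‖ ^ 2 := hG
    _ ≤ M ^ 2 * (C ^ 2 * ‖pullback F h v‖ ^ 2) := mul_le_mul_of_nonneg_left hC2 (sq_nonneg M)
    _ = c * ((M * C) ^ 2 * ∫ x in F '' S, ‖v x‖ ^ 2) := by rw [hv]; ring

theorem interior_image_affineEquiv {d : ℕ} (F : Space d ≃ᵃ[ℝ] Space d) (K : Set (Space d)) :
    interior (F '' K) = F '' interior K :=
  (Homeomorph.image_interior (affineHomeomorph F) K).symm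

/-! ### From cells to the whole mesh -/

namespace AffineMesh

variable {d : ℕ} {R : ReferenceElement d} {Ω : Set (Space d)}

theorem image_interior_subset (T : AffineMesh R Ω) {F : Space d ≃ᵃ[ℝ] Space d}
    (hF : F ∈ T.maps) : F '' interior R.cell ⊆ Ω := by
  rw [← interior_image_affineEquiv]
  exact T.interior_subset F hF

/-- The interiors of the cells cover the domain up to a null set. -/
theorem iUnion_image_interior_ae_eq (T : AffineMesh R Ω) :
    (⋃ F ∈ T.maps, F '' interior R.cell : Set (Space d)) =ᵐ[volume] Ω := by
  have hsub : (⋃ F ∈ T.maps, F '' interior R.cell : Set (Space d)) ⊆ Ω :=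
    Set.iUnion₂_subset fun F hF => T.image_interior_subset hF
  refine ae_eq_set.2 ⟨by rw [Set.sdiff_eq_empty.2 hsub, measure_empty], ?_⟩
  refine measure_mono_null (t := ⋃ F ∈ T.maps, F '' frontier R.cell) ?_ ?_
  · rintro x ⟨hx, hxi⟩
    have hx' := subset_closure hx
    rw [← T.cover] at hx'
    simp only [Set.mem_iUnion] at hx' hxi ⊢
    obtain ⟨F, hF, z, hz, rfl⟩ := hx'
    refine ⟨F, hF, z, ⟨subset_closure hz, fun hzi => hxi ⟨F, hF, z, hzi, rfl⟩⟩, rfl⟩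
  · refine (measure_biUnion_null_iff T.maps.countable_toSet).2 fun F _ => ?_
    -- Nullity of the image of the boundary is encoded as "`False` holds almost everywhere on it".
    have h := ae_of_ae_comp_affineEquiv F (S := frontier R.cell) (p := fun _ => False)
      (by rw [Measure.restrict_eq_zero.2 R.frontier_null]; simp)
    rw [ae_iff] at h
    simpa using h

/-- Integrals over the domain are sums of integrals over the cells. -/
theorem setIntegral_eq_sum (T : AffineMesh R Ω) {f : Space d → ℝ} (hf : IntegrableOn f Ω) :
    ∫ x in Ω, f x = ∑ F ∈ T.maps, ∫ x in F '' interior R.cell, f x := by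
  rw [← setIntegral_congr_set T.iUnion_image_interior_ae_eq]
  refine integral_biUnion_finset T.maps (fun F _ => ?_) (fun F hF F' hF' hne => ?_)
    (fun F hF => hf.mono_set (T.image_interior_subset hF))
  · rw [← interior_image_affineEquiv]; exact measurableSet_interior
  · have := T.disjoint_interior F hF F' hF' hne
    rwa [interior_image_affineEquiv, interior_image_affineEquiv] at this

/-- Some cell exists because the cells cover the nonempty Ω. In positive dimension a cell with an
interior point has more than one point. -/
theorem meshDiam_pos (T : AffineMesh R Ω) (hd : 0 < d) (hΩ : Ω.Nonempty) : 0 < T.meshDiam := by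
  have : Nonempty (Fin d) := ⟨⟨0, hd⟩⟩
  obtain ⟨x, hx⟩ := hΩ
  have hx' := subset_closure hx
  rw [← T.cover] at hx'
  simp only [Set.mem_iUnion] at hx'
  obtain ⟨F, hF, -⟩ := hx'
  obtain ⟨z, hz⟩ := R.nonempty_interior
  have hnt : R.cell.Nontrivial :=
    (infinite_of_mem_nhds z (mem_interior_iff_mem_nhds.1 hz)).nontrivial
  have hb : Bornology.IsBounded (F '' R.cell) :=
    (R.isCompact_cell.image (continuous_affineEquiv F)).isBounded
  exact (Metric.diam_pos (hnt.image F.injective) hb).trans_le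
    (le_ciSup (f := fun F : T.maps => Metric.diam (F.1 '' R.cell))
      (Set.finite_range _).bddAbove ⟨F, hF⟩)

/-- Inverse inequality: the gradient of a finite element function is controlled by the
function itself. -/
theorem norm_weakGradient_le (T : AffineMesh R Ω) (hh : 0 < T.meshDiam) {ρ : ℝ} (hρ : 0 < ρ)
    (hT : T.QuasiUniform ρ) {V : Submodule ℝ (L2 Ω)} (hV : T.IsConformingSpace V) {C : ℝ}
    (hC0 : 0 ≤ C) (hC : ∀ p ∈ R.shape, ∀ G : L2Vec (interior R.cell),
      IsWeakGradient (interior R.cell) p G → ‖G‖ ≤ C * ‖p‖) {v : L2 Ω} (hv : v ∈ V) :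
    ‖weakGradient Ω v‖ ≤ Metric.diam R.cell / (ρ * T.meshDiam) * C * ‖v‖ := by
  obtain ⟨hv1, hvp⟩ := hV v hv
  have hcell : ∀ F ∈ T.maps, ∫ x in F '' interior R.cell, ‖weakGradient Ω v x‖ ^ 2 ≤
      (Metric.diam R.cell / (ρ * T.meshDiam) * C) ^ 2 *
        ∫ x in F '' interior R.cell, ‖v x‖ ^ 2 := fun F hF => by
    have hsub := T.image_interior_subset hF
    obtain ⟨x, hx⟩ := hT F hF
    obtain ⟨p, hp, hvp⟩ := hvp F hF
    have hpb : pullback F hsub v = p := Lp.ext ((coeFn_pullback F hsub v).trans hvp)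
    refine setIntegral_norm_gradient_sq_le F hsub (fun w => ?_) ?_
    · have := norm_linearPart_symm_le F R.isCompact_cell.isBounded (by positivity) hx w
      rwa [mul_div_cancel₀ _ two_ne_zero] at this
    · refine hC _ (hpb ▸ hp) _ (hv1.isWeakGradient.pullback F hsub)
  -- Squared norms are sums over the cells, so the cellwise bounds with a common constant can be
  -- added.
  refine le_of_sq_le_sq ?_ (by positivity)
  rw [mul_pow, norm_sq_eq_integral, norm_sq_eq_integral,
    T.setIntegral_eq_sum (integrable_norm_sq _), T.setIntegral_eq_sum (integrable_norm_sq _),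
    Finset.mul_sum]
  exact Finset.sum_le_sum hcell

/-- A conforming finite element space is finite-dimensional. -/
theorem finiteDimensional (T : AffineMesh R Ω) {V : Submodule ℝ (L2 Ω)}
    (hV : T.IsConformingSpace V) : FiniteDimensional ℝ V := by
  have := R.finiteDimensional_shape
  have hmem : ∀ (F : T.maps) (v : V),
      pullback F.1 (T.image_interior_subset F.2) (v : L2 Ω) ∈ R.shape := fun F v => by
    obtain ⟨p, hp, h⟩ := (hV v v.2).2 F F.2
    rwa [Lp.ext ((coeFn_pullback F.1 (T.image_interior_subset F.2) v).trans h)]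
  -- A function in V is determined by its pullbacks to the reference cell, one per mesh cell, each
  -- in the finite-dimensional shape space.
  let f : V →ₗ[ℝ] (T.maps → R.shape) := LinearMap.pi fun F =>
    ((pullback F.1 (T.image_interior_subset F.2)).comp V.subtype).codRestrict R.shape (hmem F)
  refine FiniteDimensional.of_injective f ((injective_iff_map_eq_zero f).2 fun v hv => ?_)
  have hz : ∀ F ∈ T.maps, ∀ᵐ x ∂volume.restrict (F '' interior R.cell), (v : L2 Ω) x = 0 := by
    intro F hF
    refine ae_of_ae_comp_affineEquiv F ?_
    have h0 : pullback F (T.image_interior_subset hF) (v : L2 Ω) = 0 :=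
      congrArg Subtype.val (congrFun hv ⟨F, hF⟩)
    have h1 := coeFn_pullback F (T.image_interior_subset hF) (v : L2 Ω)
    rw [h0] at h1
    filter_upwards [h1, Lp.coeFn_zero ℝ 2 (volume.restrict (interior R.cell))] with x hx hx0
    rw [← hx, hx0, Pi.zero_apply]
  refine Subtype.ext (Lp.ext ?_)
  have h1 : ∀ᵐ x ∂volume.restrict Ω, (v : L2 Ω) x = 0 := by
    have h2 := (ae_restrict_biUnion_finset_iff _ T.maps fun x => (v : L2 Ω) x = 0).2 hz
    refine (Measure.restrict_congr_set T.iUnion_image_interior_ae_eq).symm.absolutelyContinuous h2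
  filter_upwards [h1, Lp.coeFn_zero ℝ 2 (volume.restrict Ω)] with x hx hx0
  rw [hx, ZeroMemClass.coe_zero, hx0, Pi.zero_apply]

end AffineMesh

/-! ### Nondegeneracy of the energy norm and finiteness of the dual norm -/

/-- A mean-zero function with vanishing weak gradient on a domain is zero. -/
theorem eq_zero_of_weakGradient_eq_zero {d : ℕ} {Ω : Set (Space d)} (hΩ : IsOpen Ω)
    (hc : IsConnected Ω) (hb : Bornology.IsBounded Ω) {u : L2 Ω} (hu : MemH1 Ω u)
    (hg : weakGradient Ω u = 0) (h0 : ∫ x in Ω, u x = 0) : u = 0 := by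
  have h := hu.isWeakGradient
  rw [hg] at h
  obtain ⟨c, hcu⟩ := h.ae_eq_const hΩ hc
  rw [integral_congr_ae hcu, setIntegral_const, smul_eq_mul] at h0
  have hpos : 0 < volume.real Ω :=
    ENNReal.toReal_pos (hΩ.measure_pos volume hc.nonempty).ne' hb.measure_lt_top.ne
  have hc0 : c = 0 := (mul_eq_zero.1 h0).resolve_left hpos.ne'
  refine Lp.ext (hcu.trans ?_)
  filter_upwards [Lp.coeFn_zero ℝ 2 (volume.restrict Ω)] with x hx
  rw [hx, hc0, Pi.zero_apply]

theorem energyNorm_eq {d : ℕ} {Ω : Set (Space d)} (y : ℝ) (v : L2 Ω) :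
    energyNorm y v = Real.sqrt y * ‖weakGradient Ω v‖ := by
  rw [energyNorm, norm_smul, Real.norm_of_nonneg (Real.sqrt_nonneg y)]

theorem toDual_apply {d : ℕ} {Ω : Set (Space d)} (V₀ : Submodule ℝ (L2 Ω)) (q l : V₀) :
    toDual V₀ q l = inner ℝ (q : L2 Ω) (l : L2 Ω) := rfl

/-- The set defining the dual norm is bounded above if the gradient is injective on a
finite-dimensional space. -/
theorem bddAbove_dualNorm {d : ℕ} {Ω : Set (Space d)} (hΩ : IsOpen Ω) {y : ℝ} (hy : 0 < y)
    (V₀ : Submodule ℝ (L2 Ω)) [FiniteDimensional ℝ V₀] (hV : ∀ v ∈ V₀, MemH1 Ω v)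
    (hinj : ∀ v ∈ V₀, weakGradient Ω v = 0 → v = 0) (q : V₀) :
    BddAbove {r : ℝ | ∃ l : V₀, energyNorm y (l : L2 Ω) ≠ 0 ∧
      r = toDual V₀ q l / energyNorm y (l : L2 Ω)} := by
  -- An injective linear map on a finite-dimensional space is bounded below. Here K may depend on
  -- V₀; only finiteness matters.
  obtain ⟨K, _, hK⟩ := (gradientOn hΩ V₀ hV).exists_antilipschitzWith
    (LinearMap.ker_eq_bot'.2 fun v hv => Subtype.ext (hinj v v.2 hv))
  have hs : 0 < Real.sqrt y := Real.sqrt_pos.2 hy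
  refine ⟨‖(q : L2 Ω)‖ * K / Real.sqrt y, ?_⟩
  rintro r ⟨l, hl, rfl⟩
  have hl0 : 0 < energyNorm y (l : L2 Ω) := lt_of_le_of_ne (norm_nonneg _) hl.symm
  have h1 : ‖(l : L2 Ω)‖ ≤ K * ‖weakGradient Ω (l : L2 Ω)‖ :=
    hK.le_mul_norm (map_zero _) l
  have h2 : toDual V₀ q l ≤ ‖(q : L2 Ω)‖ * ‖(l : L2 Ω)‖ := by
    rw [toDual_apply]
    exact real_inner_le_norm _ _
  rw [div_le_iff₀ hl0, energyNorm_eq]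
  calc toDual V₀ q l ≤ ‖(q : L2 Ω)‖ * ‖(l : L2 Ω)‖ := h2
    _ ≤ ‖(q : L2 Ω)‖ * (K * ‖weakGradient Ω (l : L2 Ω)‖) :=
      mul_le_mul_of_nonneg_left h1 (norm_nonneg _)
    _ = _ := by field_simp

end FEInverse
end

/-! ### The inverse inequality in the dual norm -/

theorem mainTheorem6 {d : ℕ} (hd : d = 2 ∨ d = 3)
    (Ω : Set (FEInverse.Space d)) (hΩ_open : IsOpen Ω) (hΩ_conn : IsConnected Ω)
    (hΩ_bdd : Bornology.IsBounded Ω)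
    (R : FEInverse.ReferenceElement d) (ρ : ℝ) (hρ : 0 < ρ) (y : ℝ) (hy : 0 < y) :
    ∃ Cinv : ℝ, 0 < Cinv ∧
      ∀ T : FEInverse.AffineMesh R Ω, T.QuasiUniform ρ →
        ∀ V : Submodule ℝ (FEInverse.L2 Ω), T.IsConformingSpace V →
          ∀ q : FEInverse.meanZero V,
            ‖(q : FEInverse.L2 Ω)‖ ≤
              Cinv / T.meshDiam *
                FEInverse.dualNorm y (FEInverse.meanZero V)
                  (FEInverse.toDual (FEInverse.meanZero V) q) := by
  obtain ⟨C, hC0, hC⟩ := R.exists_gradient_bound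
  have hB0 : 0 ≤ Real.sqrt y * (Metric.diam R.cell / ρ) * C := by positivity
  -- The summand 1 keeps the constant positive even when C = 0.
  refine ⟨Real.sqrt y * (Metric.diam R.cell / ρ) * C + 1, by positivity,
    fun T hT V hV q => ?_⟩
  have hh := T.meshDiam_pos (by omega) hΩ_conn.nonempty
  have hle : FEInverse.meanZero V ≤ V := fun v hv => hv.1
  have := T.finiteDimensional hV
  have : FiniteDimensional ℝ (FEInverse.meanZero V) := Submodule.finiteDimensional_of_le hle
  have hH1 : ∀ v ∈ FEInverse.meanZero V, FEInverse.MemH1 Ω v := fun v hv => (hV v hv.1).1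
  have hinj : ∀ v ∈ FEInverse.meanZero V, FEInverse.weakGradient Ω v = 0 → v = 0 :=
    fun v hv hg => FEInverse.eq_zero_of_weakGradient_eq_zero hΩ_open hΩ_conn hΩ_bdd (hH1 v hv)
      hg hv.2.2
  have hbdd := FEInverse.bddAbove_dualNorm hΩ_open hy (FEInverse.meanZero V) hH1 hinj q
  rcases eq_or_ne (q : FEInverse.L2 Ω) 0 with hq | hq
  · rw [hq, norm_zero]
    refine mul_nonneg (by positivity) (Real.sSup_nonneg ?_)
    rintro r ⟨l, -, rfl⟩
    rw [FEInverse.toDual_apply, hq, inner_zero_left, zero_div]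
  have hE : 0 < FEInverse.energyNorm y (q : FEInverse.L2 Ω) := by
    rw [FEInverse.energyNorm_eq]
    exact mul_pos (Real.sqrt_pos.2 hy) (norm_pos_iff.2 fun h => hq (hinj _ q.2 h))
  have hqn : 0 < ‖(q : FEInverse.L2 Ω)‖ := norm_pos_iff.2 hq
  -- The choice l = q in the supremum.
  have hsup : ‖(q : FEInverse.L2 Ω)‖ ^ 2 / FEInverse.energyNorm y (q : FEInverse.L2 Ω) ≤
      FEInverse.dualNorm y (FEInverse.meanZero V)
        (FEInverse.toDual (FEInverse.meanZero V) q) := by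
    refine le_csSup hbdd ⟨q, hE.ne', ?_⟩
    rw [FEInverse.toDual_apply, real_inner_self_eq_norm_sq]
  rw [div_le_iff₀ hE] at hsup
  have hD := pos_of_mul_pos_left (lt_of_lt_of_le (by positivity) hsup) hE.le
  have hinv : FEInverse.energyNorm y (q : FEInverse.L2 Ω) ≤
      (Real.sqrt y * (Metric.diam R.cell / ρ) * C + 1) / T.meshDiam *
        ‖(q : FEInverse.L2 Ω)‖ := by
    rw [FEInverse.energyNorm_eq]
    calc _ ≤ Real.sqrt y * (Metric.diam R.cell / (ρ * T.meshDiam) * C *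
          ‖(q : FEInverse.L2 Ω)‖) := mul_le_mul_of_nonneg_left
            (T.norm_weakGradient_le hh hρ hT hV hC0 hC q.2.1) (Real.sqrt_nonneg y)
      _ = Real.sqrt y * (Metric.diam R.cell / ρ) * C / T.meshDiam *
          ‖(q : FEInverse.L2 Ω)‖ := by field_simp
      _ ≤ _ := by gcongr; linarith
  -- Bounding the energy norm of q in ‖q‖² ≤ ‖q‖_* ‖q‖_{h,y} by the inverse inequality leaves one
  -- factor ‖q‖ to cancel.
  refine le_of_mul_le_mul_right ?_ hqn
  calc _ = ‖(q : FEInverse.L2 Ω)‖ ^ 2 := (sq _).symm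
    _ ≤ _ := hsup.trans (mul_le_mul_of_nonneg_left hinv hD.le)
    _ = _ := by ring
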